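/- Let $c_0$ be the space of real sequences converging to $0$, with the supremum norm. Let $X$ be a real Banach space that contains an isomorphic copy of $c_0$, that is, a linear subspace which, with the norm of $X$, is linearly homeomorphic to $c_0$. Then $X$ contains an infinite equilateral set: there are an infinite set $S \subseteq X$ and a real number $\lambda > 0$ such that $\|x-y\| = \lambda$ for all $x, y \in S$ with $x \neq y$. -/

import Mathlib

open scoped ZeroAtInfty

/-- A subset `S` of a metric space is equilateral if for some `r > 0` any two distinct points
of `S` are at distance exactly `r`. -/
def IsEquilateral {M : Type*} [MetricSpace M] (S : Set M) : Prop :=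
  ∃ r : ℝ, 0 < r ∧ ∀ x ∈ S, ∀ y ∈ S, x ≠ y → dist x y = r

/-- The real normed space `X` contains an isomorphic copy of `c₀`: some linear subspace of `X`,
with the norm of `X`, is linearly homeomorphic to `c₀`. Here `C₀(ℕ, ℝ)` is the space of real
sequences tending to zero, with the supremum norm. -/
def ContainsIsomorphicCopyOfC0 (X : Type*) [NormedAddCommGroup X] [NormedSpace ℝ X] : Prop :=
  ∃ Y : Submodule ℝ X, Nonempty (C₀(ℕ, ℝ) ≃L[ℝ] Y)

/-!
Write `e n` for the unit vectors of `c₀`, and work with finitely supported sequences only.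

By James' distortion argument, a space containing a copy of `c₀` contains almost isometric copies:
passing to normalised blocks far out, the norm `N` of `X` on finitely supported sequences satisfies
`(17/18) * ‖x‖∞ ≤ N x ≤ ‖x‖∞` (`HasC0Bounds.exists_almost_isometric`).

The equilateral set consists of vectors `p n = e n - ∑ i < n, c i • e i` with coefficients
`c i ∈ [3/4, 5/4]`, built recursively so that `N (p i - p n) = 2` for all `i < n`. The `i`-th coordinate
of `p i - p n` is `1 + c i ≥ 7/4`, while all other coordinates are at most `5/4` in absolute value.
Since the `i`-th coordinate dominates with room to spare, convexity of `N` shows that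
`N (p i - p n) - c i` is a Lipschitz function of `c` with constant `1/2`
(`HasC0Bounds.norm_sub_norm_le`), although `N` need not be differentiable. Hence the map
`c ↦ (c i + 2 - N (p i - p n))` over the indices `i < n` is a contraction of the cube
`[3/4, 5/4]ⁿ`, and its fixed point gives the coefficients of `p n`
(`HasC0Bounds.exists_staircase_dist_eq_two`).
-/

/-- A linear map `T` on finitely supported sequences satisfies
`a * ‖x‖∞ ≤ ‖T x‖ ≤ b * ‖x‖∞`, the supremum norm being expressed through the coordinates. -/
structure HasC0Bounds {X : Type*} [NormedAddCommGroup X] [NormedSpace ℝ X]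
    (T : (ℕ →₀ ℝ) →ₗ[ℝ] X) (a b : ℝ) : Prop where
  upper : ∀ (x : ℕ →₀ ℝ) (M : ℝ), (∀ n, |x n| ≤ M) → ‖T x‖ ≤ b * M
  lower : ∀ (x : ℕ →₀ ℝ) (n : ℕ), a * |x n| ≤ ‖T x‖

/-- The inclusion of the finitely supported sequences into `c₀`. -/
def finsuppToC0 : (ℕ →₀ ℝ) →ₗ[ℝ] C₀(ℕ, ℝ) where
  toFun x :=
    { toFun := x
      continuous_toFun := continuous_of_discreteTopology
      zero_at_infty' := by
        rw [Filter.cocompact_eq_cofinite]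
        refine tendsto_const_nhds.congr' ?_
        filter_upwards [x.hasFiniteSupport.compl_mem_cofinite] with n hn
        simpa [eq_comm] using hn }
  map_add' _ _ := rfl
  map_smul' _ _ := rfl

theorem ContainsIsomorphicCopyOfC0.exists_hasC0Bounds {X : Type*} [NormedAddCommGroup X]
    [NormedSpace ℝ X] (hX : ContainsIsomorphicCopyOfC0 X) :
    ∃ (T : (ℕ →₀ ℝ) →ₗ[ℝ] X) (a b : ℝ), 0 < a ∧ HasC0Bounds T a b := by
  obtain ⟨Y, ⟨e⟩⟩ := hX
  refine ⟨Y.subtype ∘ₗ (e : C₀(ℕ, ℝ) →ₗ[ℝ] Y) ∘ₗ finsuppToC0,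
    (‖(e.symm : Y →L[ℝ] C₀(ℕ, ℝ))‖ + 1)⁻¹, ‖(e : C₀(ℕ, ℝ) →L[ℝ] Y)‖, by positivity, ?_, ?_⟩
  · intro x M hM
    have h1 : ‖finsuppToC0 x‖ ≤ M := by
      rw [← ZeroAtInftyContinuousMap.norm_toBCF_eq_norm]
      exact (BoundedContinuousFunction.norm_le ((abs_nonneg _).trans (hM 0))).2 hM
    exact ((e : C₀(ℕ, ℝ) →L[ℝ] Y).le_opNorm _).trans (by gcongr)
  · intro x n
    have h1 : |x n| ≤ ‖finsuppToC0 x‖ := by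
      rw [← ZeroAtInftyContinuousMap.norm_toBCF_eq_norm]
      exact (finsuppToC0 x).toBCF.norm_coe_le_norm n
    have h2 := (e.symm : Y →L[ℝ] C₀(ℕ, ℝ)).le_opNorm (e (finsuppToC0 x))
    simp only [ContinuousLinearEquiv.coe_coe, ContinuousLinearEquiv.symm_apply_apply] at h2
    rw [inv_mul_le_iff₀ (by positivity)]
    refine h1.trans (h2.trans ?_)
    change _ ≤ _ * ‖e (finsuppToC0 x)‖
    gcongr
    linarith

/-! ### Almost isometric copies of `c₀` -/

/-- Combining disjointly supported vectors from the unit ball does not increase the supremum norm. -/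
theorem abs_linearCombination_le_of_disjoint {u : ℕ → ℕ →₀ ℝ}
    (hdisj : ∀ j k n, u j n ≠ 0 → u k n ≠ 0 → j = k) (hu : ∀ k n, |u k n| ≤ 1)
    (c : ℕ →₀ ℝ) {M : ℝ} (hc : ∀ n, |c n| ≤ M) (n : ℕ) :
    |Finsupp.linearCombination ℝ u c n| ≤ M := by
  have hM : 0 ≤ M := (abs_nonneg _).trans (hc 0)
  rw [Finsupp.linearCombination_apply, Finsupp.sum, Finsupp.finsetSum_apply]
  simp only [Finsupp.smul_apply, smul_eq_mul]
  by_cases h : ∃ k, u k n ≠ 0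
  · obtain ⟨k, hk⟩ := h
    rw [Finset.sum_eq_single k]
    · rw [abs_mul]
      exact (mul_le_mul (hc k) (hu k n) (abs_nonneg _) hM).trans_eq (mul_one M)
    · intro j _ hj
      by_contra h0
      exact hj (hdisj j k n (right_ne_zero_of_mul h0) hk)
    · intro hk0
      simp [Finsupp.notMem_support_iff.1 hk0]
  · push Not at h
    simpa [h] using hM

/-- If arbitrarily far out there are unit-ball vectors satisfying `P`, there is a disjointly
supported sequence of them beyond any given index. -/
theorem exists_disjoint_blocks {P : (ℕ →₀ ℝ) → Prop}
    (h : ∀ n, ∃ x : ℕ →₀ ℝ, (∀ i < n, x i = 0) ∧ P x) (n₀ : ℕ) :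
    ∃ u : ℕ → ℕ →₀ ℝ, (∀ j k n, u j n ≠ 0 → u k n ≠ 0 → j = k) ∧
      (∀ k, ∀ i < n₀, u k i = 0) ∧ ∀ k, P (u k) := by
  have h' : ∀ n, ∃ (x : ℕ →₀ ℝ) (b : ℕ), n ≤ b ∧ (∀ i, x i ≠ 0 → n ≤ i ∧ i < b) ∧ P x := by
    intro n
    obtain ⟨x, hx, hP⟩ := h n
    refine ⟨x, max n (x.support.sup id + 1), le_max_left _ _, fun i hi => ⟨?_, ?_⟩, hP⟩
    · by_contra hlt
      exact hi (hx i (not_le.1 hlt))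
    · have := Finset.le_sup (f := id) (Finsupp.mem_support_iff.2 hi)
      simp only [id] at this
      omega
  choose f b hb hf hP using h'
  let m : ℕ → ℕ := fun k => b^[k] n₀
  have hmsucc : ∀ k, m (k + 1) = b (m k) := fun k => Function.iterate_succ_apply' b k n₀
  have hmono : Monotone m := monotone_nat_of_le_succ fun k => (hb _).trans_eq (hmsucc k).symm
  have hlt : ∀ j k n, j < k → f (m j) n ≠ 0 → f (m k) n ≠ 0 → False := by
    intro j k n hjk hj hk
    have h1 := (hf _ _ hj).2
    have h2 := (hf _ _ hk).1
    have h3 : m (j + 1) ≤ m k := hmono hjk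
    rw [hmsucc] at h3
    omega
  refine ⟨fun k => f (m k), ?_, ?_, fun k => hP _⟩
  · intro j k n hj hk
    rcases lt_trichotomy j k with h | h | h
    · exact (hlt j k n h hj hk).elim
    · exact h
    · exact (hlt k j n h hk hj).elim
  · intro k i hi
    by_contra h0
    have h1 := (hf _ _ h0).1
    have h3 : m 0 ≤ m k := hmono (Nat.zero_le k)
    have h4 : m 0 = n₀ := rfl
    omega

/-- James' distortion theorem for `c₀`. The asymptotic norm `K` of `T` on tails is almost attained on
a disjoint sequence of blocks. Flipping the signs of all but the largest coefficient of a combination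
of these blocks preserves the upper bound, which forces the lower bound. -/
theorem HasC0Bounds.exists_almost_isometric {X : Type*} [NormedAddCommGroup X] [NormedSpace ℝ X]
    {T : (ℕ →₀ ℝ) →ₗ[ℝ] X} {a b : ℝ} (ha : 0 < a) (hT : HasC0Bounds T a b)
    {η : ℝ} (hη : 0 < η) :
    ∃ S : (ℕ →₀ ℝ) →ₗ[ℝ] X, HasC0Bounds S (1 - η) 1 := by
  let A : Set ℝ := {t | ∃ n : ℕ, ∀ x : ℕ →₀ ℝ, (∀ i < n, x i = 0) → (∀ i, |x i| ≤ 1) → ‖T x‖ ≤ t}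
  have hAne : A.Nonempty := ⟨b, 0, fun x _ hx => by simpa using hT.upper x 1 hx⟩
  have hAlb : ∀ t ∈ A, a ≤ t := by
    rintro t ⟨n, hn⟩
    have h1 := hn (Finsupp.single n 1)
      (fun i hi => by rw [Finsupp.single_apply, if_neg (by omega)])
      (fun i => by rw [Finsupp.single_apply]; split_ifs <;> simp)
    have h2 := hT.lower (Finsupp.single n 1) n
    simp only [Finsupp.single_eq_same, abs_one, mul_one] at h2
    exact h2.trans h1
  set K := sInf A with hK
  have hKpos : 0 < K := ha.trans_le (le_csInf hAne hAlb)
  obtain ⟨t, ⟨n₀, hn₀⟩, ht⟩ : ∃ t ∈ A, t < K * (1 + η / 4) :=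
    exists_lt_of_csInf_lt hAne (by rw [← hK]; nlinarith)
  have hfar : ∀ n, ∃ x : ℕ →₀ ℝ, (∀ i < n, x i = 0) ∧
      ((∀ i, |x i| ≤ 1) ∧ K * (1 - η / 4) < ‖T x‖) := by
    intro n
    by_contra! hcon
    have hmem : K * (1 - η / 4) ∈ A := ⟨n, hcon⟩
    have := csInf_le ⟨a, hAlb⟩ hmem
    nlinarith
  obtain ⟨u, hdisj, htail, hu⟩ := exists_disjoint_blocks hfar n₀
  set L := K * (1 + η / 4) with hL
  have hLpos : 0 < L := by positivity
  set U := Finsupp.linearCombination ℝ u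
  have hup : ∀ (x : ℕ →₀ ℝ) (M : ℝ), (∀ n, |x n| ≤ M) → ‖T (U x)‖ ≤ L * M := by
    intro x M hM
    have hM0 : 0 ≤ M := (abs_nonneg _).trans (hM 0)
    rcases hM0.eq_or_lt with h0 | hMpos
    · have hx : x = 0 := by
        ext n
        exact abs_nonpos_iff.1 (h0 ▸ hM n)
      simp [hx, ← h0]
    have h1 : ‖T (M⁻¹ • U x)‖ ≤ t := by
      apply hn₀
      · intro i hi
        rw [Finsupp.smul_apply, Finsupp.linearCombination_apply, Finsupp.sum,
          Finsupp.finsetSum_apply]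
        simp [htail _ i hi]
      · intro i
        rw [Finsupp.smul_apply, smul_eq_mul, abs_mul, abs_of_pos (inv_pos.2 hMpos),
          inv_mul_le_iff₀ hMpos, mul_one]
        exact abs_linearCombination_le_of_disjoint hdisj (fun k => (hu k).1) x hM i
    rw [map_smul, norm_smul, norm_inv, Real.norm_of_nonneg hM0, inv_mul_le_iff₀ hMpos] at h1
    nlinarith
  have hlow : ∀ (x : ℕ →₀ ℝ) (k : ℕ), (∀ n, |x n| ≤ |x k|) → L * (1 - η) * |x k| ≤ ‖T (U x)‖ := by
    intro x k hk
    have h1 := hup (Finsupp.single k (2 * x k) - x) |x k| (by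
      intro n
      rw [Finsupp.sub_apply, Finsupp.single_apply]
      split_ifs with h
      · subst h
        rw [two_mul, add_sub_cancel_right]
      · rw [zero_sub, abs_neg]
        exact hk n)
    have h2 : (2 * x k) • T (u k) = T (U (Finsupp.single k (2 * x k) - x)) + T (U x) := by
      rw [← map_add, ← map_add, sub_add_cancel, Finsupp.linearCombination_single, map_smul]
    have h3 : ‖(2 * x k) • T (u k)‖ = 2 * |x k| * ‖T (u k)‖ := by
      rw [norm_smul, Real.norm_eq_abs, abs_mul, abs_two]
    have h4 := norm_add_le (T (U (Finsupp.single k (2 * x k) - x))) (T (U x))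
    rw [← h2, h3] at h4
    have h5 := mul_le_mul_of_nonneg_left (hu k).2.le (abs_nonneg (x k))
    have h6 : 0 ≤ K * η ^ 2 * |x k| := by positivity
    rw [hL] at h1 ⊢
    nlinarith
  refine ⟨L⁻¹ • (T ∘ₗ U), fun x M hM => ?_, fun x n => ?_⟩
  · rw [LinearMap.smul_apply, norm_smul, norm_inv, Real.norm_of_nonneg hLpos.le,
      inv_mul_le_iff₀ hLpos, one_mul]
    exact hup x M hM
  · rw [LinearMap.smul_apply, norm_smul, norm_inv, Real.norm_of_nonneg hLpos.le,
      le_inv_mul_iff₀ hLpos]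
    obtain hη1 | hη1 := le_total 1 η
    · exact (mul_nonpos_of_nonneg_of_nonpos hLpos.le
        (mul_nonpos_of_nonpos_of_nonneg (by linarith) (abs_nonneg _))).trans (norm_nonneg _)
    by_cases hxn : x n = 0
    · simp [hxn]
    obtain ⟨k, -, hk⟩ := x.support.exists_max_image (fun i => |x i|)
      ⟨n, Finsupp.mem_support_iff.2 hxn⟩
    have hmax : ∀ i, |x i| ≤ |x k| := by
      intro i
      by_cases hi : x i = 0
      · simp [hi]
      · exact hk i (Finsupp.mem_support_iff.2 hi)
    refine le_trans ?_ (hlow x k hmax)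
    rw [← mul_assoc]
    exact mul_le_mul_of_nonneg_left (hmax n) (mul_nonneg hLpos.le (by linarith))

/-! ### Norms of vectors with a dominant coordinate -/

/-- Near a vector whose `i`-th coordinate dominates, an almost isometric norm is Lipschitz close to
the `i`-th coordinate. -/
theorem HasC0Bounds.norm_sub_norm_le {X : Type*} [NormedAddCommGroup X] [NormedSpace ℝ X]
    {S : (ℕ →₀ ℝ) →ₗ[ℝ] X} (hS : HasC0Bounds S (17 / 18) 1) {y z : ℕ →₀ ℝ} {i : ℕ} {d : ℝ}
    (hd : 0 < d) (hyz : ∀ k, |z k - y k| ≤ d) (hi : 7 / 4 ≤ z i) (hi' : z i ≤ 9 / 4)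
    (hz : ∀ k, k ≠ i → |z k| ≤ 5 / 4) :
    ‖S z‖ - ‖S y‖ ≤ z i - y i + d / 2 := by
  -- Prolong the segment from `y` to `z` beyond `z` by a vector of supremum norm at most `1/4`;
  -- this is the largest step for which the `i`-th coordinate is sure to stay dominant.
  set s : ℝ := (4 * d)⁻¹ with hs
  have hspos : 0 < s := by positivity
  have hsd : s * d = 1 / 4 := by rw [hs]; field_simp
  have hstep : ∀ k, |s * (z k - y k)| ≤ 1 / 4 := by
    intro k
    rw [abs_mul, abs_of_pos hspos, ← hsd]
    gcongr
    exact hyz k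
  have hup := hS.upper (z + s • (z - y)) (z i + s * (z i - y i)) (by
    intro k
    simp only [Finsupp.add_apply, Finsupp.smul_apply, Finsupp.sub_apply, smul_eq_mul]
    have h1 := abs_le.1 (hstep i)
    have h2 := abs_le.1 (hstep k)
    by_cases hk : k = i
    · subst hk
      rw [abs_of_nonneg (by linarith)]
    · have h3 := abs_le.1 (hz k hk)
      rw [abs_le]
      constructor <;> linarith)
  have hlow := hS.lower z i
  rw [abs_of_nonneg (by linarith)] at hlow
  have hconv : (1 + s) * ‖S z‖ ≤ s * ‖S y‖ + ‖S (z + s • (z - y))‖ := by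
    have h1 : (1 + s) • S z = s • S y + S (z + s • (z - y)) := by
      rw [← map_smul, ← map_smul, ← map_add]
      congr 1
      module
    have h2 := norm_add_le (s • S y) (S (z + s • (z - y)))
    rwa [← h1, norm_smul, norm_smul, Real.norm_of_nonneg hspos.le,
      Real.norm_of_nonneg (by linarith)] at h2
  have hmul : s * (‖S z‖ - ‖S y‖) ≤ s * (z i - y i + d / 2) := by
    have : s * (z i - y i + d / 2) = s * (z i - y i) + s * d / 2 := by ring
    rw [this, hsd]
    linarith
  exact le_of_mul_le_mul_left hmul hspos

/-! ### The equilateral sequence -/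

/-- The vectors `e n - ∑ i < n, c i • e i` with all `c i ∈ [3/4, 5/4]`. -/
structure IsStaircase (n : ℕ) (p : ℕ →₀ ℝ) : Prop where
  diag : p n = 1
  below : ∀ i < n, |p i + 1| ≤ 1 / 4
  above : ∀ i, n < i → p i = 0

theorem IsStaircase.abs_sub_le {i n k : ℕ} {q p : ℕ →₀ ℝ} (hq : IsStaircase i q)
    (hp : IsStaircase n p) (hin : i < n) (hk : k ≠ i) : |(q - p) k| ≤ 5 / 4 := by
  rw [Finsupp.sub_apply, abs_le]
  rcases lt_or_gt_of_ne hk with h | h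
  · have h1 := abs_le.1 (hq.below k h)
    have h2 := abs_le.1 (hp.below k (h.trans hin))
    constructor <;> linarith
  · rw [hq.above k h]
    rcases lt_trichotomy k n with h' | h' | h'
    · have h2 := abs_le.1 (hp.below k h')
      constructor <;> linarith
    · rw [h', hp.diag]
      norm_num
    · rw [hp.above k h']
      norm_num

/-- The vector `e n - ∑ i < n, c i • e i`. -/
noncomputable def staircase (n : ℕ) (c : Fin n → ℝ) : ℕ →₀ ℝ :=
  Finsupp.onFinset (Finset.range (n + 1))
    (fun k => if h : k < n then -c ⟨k, h⟩ else if k = n then 1 else 0) (by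
      intro k hk
      rw [Finset.mem_range]
      by_contra hlt
      exact hk (by rw [dif_neg (by omega), if_neg (by omega)]))

theorem staircase_apply {n : ℕ} (c : Fin n → ℝ) (k : ℕ) :
    staircase n c k = if h : k < n then -c ⟨k, h⟩ else if k = n then 1 else 0 := rfl

theorem staircase_apply_fin {n : ℕ} (c : Fin n → ℝ) (i : Fin n) : staircase n c i = -c i := by
  rw [staircase_apply, dif_pos i.2]

theorem isStaircase_staircase {n : ℕ} {c : Fin n → ℝ} (hc : ∀ i, |c i - 1| ≤ 1 / 4) :
    IsStaircase n (staircase n c) where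
  diag := by simp [staircase_apply]
  below i hi := by
    rw [staircase_apply, dif_pos hi, ← abs_neg, neg_add, neg_neg, ← sub_eq_add_neg]
    exact hc _
  above i hi := by rw [staircase_apply, dif_neg (by omega), if_neg (by omega)]

theorem abs_staircase_sub_le {n : ℕ} (c c' : Fin n → ℝ) (k : ℕ) :
    |staircase n c k - staircase n c' k| ≤ dist c c' := by
  rw [staircase_apply, staircase_apply]
  split_ifs with h
  · have h1 := dist_le_pi_dist c c' ⟨k, h⟩
    rw [Real.dist_eq] at h1
    rwa [neg_sub_neg, abs_sub_comm]
  · simp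
  · simp

/-- Any `n` staircase vectors of index below `n` extend by one of index `n` at distance `2` from all
of them; the coefficients are the fixed point of a contraction. -/
theorem HasC0Bounds.exists_staircase_dist_eq_two {X : Type*} [NormedAddCommGroup X]
    [NormedSpace ℝ X] {S : (ℕ →₀ ℝ) →ₗ[ℝ] X} (hS : HasC0Bounds S (17 / 18) 1) (n : ℕ)
    (q : ℕ → ℕ →₀ ℝ) (hq : ∀ i < n, IsStaircase i (q i)) :
    ∃ p, IsStaircase n p ∧ ∀ i < n, ‖S (q i - p)‖ = 2 := by
  let F : (Fin n → ℝ) → Fin n → ℝ := fun c i => c i + 2 - ‖S (q i - staircase n c)‖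
  let B : Set (Fin n → ℝ) := Metric.closedBall 1 (1 / 4)
  have hB : ∀ c, c ∈ B ↔ ∀ i, |c i - 1| ≤ 1 / 4 := by
    intro c
    rw [Metric.mem_closedBall, dist_pi_le_iff (by norm_num)]
    simp [Real.dist_eq]
  have hval : ∀ (c : Fin n → ℝ) (i : Fin n), (q i - staircase n c) i = 1 + c i := by
    intro c i
    rw [Finsupp.sub_apply, (hq i i.2).diag, staircase_apply_fin, sub_neg_eq_add]
  have hother : ∀ c ∈ B, ∀ (i : Fin n) (k : ℕ), k ≠ i → |(q i - staircase n c) k| ≤ 5 / 4 :=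
    fun c hc i k hk => (hq i i.2).abs_sub_le (isStaircase_staircase ((hB c).1 hc)) i.2 hk
  have hmaps : Set.MapsTo F B B := by
    intro c hc
    rw [hB]
    intro i
    have hci := abs_le.1 ((hB c).1 hc i)
    have hlow := hS.lower (q i - staircase n c) i
    have hup := hS.upper (q i - staircase n c) (1 + c i) (by
      intro k
      by_cases hk : k = i
      · rw [hk, hval, abs_of_nonneg (by linarith)]
      · exact (hother c hc i k hk).trans (by linarith))
    rw [hval, abs_of_nonneg (by linarith)] at hlow
    change |c i + 2 - ‖S (q i - staircase n c)‖ - 1| ≤ 1 / 4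
    rw [abs_le]
    constructor <;> linarith
  have hlip : ∀ c ∈ B, ∀ c' ∈ B, dist (F c) (F c') ≤ 1 / 2 * dist c c' := by
    intro c hc c' hc'
    rcases (dist_nonneg (x := c) (y := c')).eq_or_lt with h0 | hpos
    · rw [dist_eq_zero.1 h0.symm]
      simp
    rw [dist_pi_le_iff (by positivity)]
    have key : ∀ c ∈ B, ∀ c' ∈ B, 0 < dist c c' → ∀ i : Fin n,
        ‖S (q i - staircase n c)‖ - ‖S (q i - staircase n c')‖ ≤ c i - c' i + dist c c' / 2 := by
      intro c hc c' hc' hpos i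
      have hci := abs_le.1 ((hB c).1 hc i)
      have h := hS.norm_sub_norm_le (y := q i - staircase n c') (z := q i - staircase n c)
        (i := i) hpos (fun k => by
          rw [Finsupp.sub_apply, Finsupp.sub_apply, sub_sub_sub_cancel_left, dist_comm]
          exact abs_staircase_sub_le c' c k)
        (by rw [hval]; linarith) (by rw [hval]; linarith) (hother c hc i)
      rw [hval, hval] at h
      linarith
    intro i
    have h1 := key c hc c' hc' hpos i
    have h2 := key c' hc' c hc (by rwa [dist_comm]) i
    rw [dist_comm c' c] at h2
    rw [Real.dist_eq]
    change |c i + 2 - ‖S (q i - staircase n c)‖ - (c' i + 2 - ‖S (q i - staircase n c')‖)| ≤ _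
    rw [abs_le]
    constructor <;> linarith
  have hcontr : ContractingWith (1 / 2) (hmaps.restrict F B B) := by
    refine ⟨by rw [← NNReal.coe_lt_coe]; norm_num, LipschitzWith.of_dist_le_mul fun c c' => ?_⟩
    rw [NNReal.coe_div, NNReal.coe_one, NNReal.coe_ofNat]
    exact hlip c c.2 c' c'.2
  obtain ⟨c, hc, hfix, -⟩ := hcontr.exists_fixedPoint' Metric.isClosed_closedBall.isComplete hmaps
    (Metric.mem_closedBall_self (by norm_num)) (edist_ne_top 1 _)
  refine ⟨staircase n c, isStaircase_staircase ((hB c).1 hc), fun i hi => ?_⟩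
  have h : c ⟨i, hi⟩ + 2 - ‖S (q i - staircase n c)‖ = c ⟨i, hi⟩ := congrFun hfix ⟨i, hi⟩
  linarith

/-- A sequence can be built one term at a time when `R` relates each new term to all previous ones. -/
theorem exists_seq_of_forall_extend {α : Type*} [Nonempty α] {P : ℕ → α → Prop} {R : α → α → Prop}
    (h : ∀ (n : ℕ) (q : ℕ → α), (∀ i < n, P i (q i)) → ∃ p, P n p ∧ ∀ i < n, R (q i) p) :
    ∃ p : ℕ → α, ∀ n, ∀ i < n, R (p i) (p n) := by
  classical
  have h' : ∀ (n : ℕ) (q : ℕ → α), ∃ p, (∀ i < n, P i (q i)) → P n p ∧ ∀ i < n, R (q i) p := by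
    intro n q
    by_cases hq : ∀ i < n, P i (q i)
    · obtain ⟨p, hp⟩ := h n q hq
      exact ⟨p, fun _ => hp⟩
    · exact ⟨q 0, fun h => absurd h hq⟩
  choose G hG using h'
  -- `Q n` has its first `n` values in final form.
  let Q : ℕ → ℕ → α := fun n =>
    n.rec (fun _ => Classical.arbitrary α) (fun n q => Function.update q n (G n q))
  have hQ : ∀ n, Q (n + 1) = Function.update (Q n) n (G n (Q n)) := fun _ => rfl
  let p : ℕ → α := fun n => G n (Q n)
  have hQp : ∀ n, ∀ i < n, Q n i = p i := by
    intro n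
    induction n with
    | zero => intro i hi; omega
    | succ n ih =>
      intro i hi
      rw [hQ]
      rcases Nat.lt_succ_iff_lt_or_eq.1 hi with h1 | h1
      · rw [Function.update_of_ne h1.ne, ih i h1]
      · rw [h1, Function.update_self]
  have hP : ∀ n, P n (p n) := by
    intro n
    induction n using Nat.strong_induction_on with
    | _ n ih =>
      exact (hG n (Q n) fun i hi => by rw [hQp n i hi]; exact ih i hi).1
  refine ⟨p, fun n i hi => ?_⟩
  have := (hG n (Q n) fun i hi => by rw [hQp n i hi]; exact hP i).2 i hi
  rwa [hQp n i hi] at this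

theorem theorem3 (X : Type*) [NormedAddCommGroup X] [NormedSpace ℝ X] [CompleteSpace X]
    (hX : ContainsIsomorphicCopyOfC0 X) :
    ∃ S : Set X, S.Infinite ∧ IsEquilateral S := by
  obtain ⟨T, a, b, ha, hT⟩ := hX.exists_hasC0Bounds
  obtain ⟨S, hS⟩ := hT.exists_almost_isometric ha (η := 1 / 18) (by norm_num)
  norm_num at hS
  obtain ⟨p, hp⟩ := exists_seq_of_forall_extend (R := fun q p => ‖S (q - p)‖ = 2)
    hS.exists_staircase_dist_eq_two
  have hlt : ∀ i n, i < n → dist (S (p i)) (S (p n)) = 2 := by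
    intro i n hin
    rw [dist_eq_norm, ← map_sub]
    exact hp n i hin
  have hne : ∀ i n, i ≠ n → dist (S (p i)) (S (p n)) = 2 := by
    intro i n hin
    rcases lt_or_gt_of_ne hin with h | h
    · exact hlt i n h
    · rw [dist_comm]
      exact hlt n i h
  have hinj : Function.Injective fun n => S (p n) := by
    intro i n hin
    by_contra hcon
    have h := hne i n hcon
    rw [dist_eq_zero.2 hin] at h
    norm_num at h
  refine ⟨Set.range fun n => S (p n), Set.infinite_range_of_injective hinj, 2, by norm_num, ?_⟩
  rintro _ ⟨i, rfl⟩ _ ⟨n, rfl⟩ hxy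
  exact hne i n fun h => hxy (by rw [h])
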